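/- Theorem 1 (Cautious Monotonicity Theorem). Fix a set of atoms. A rule $r$ consists of an atom $\mathrm{head}(r)$ and two finite sets of atoms $\mathrm{pos}(r)$ and $\mathrm{neg}(r)$; a (normal logic) program is an arbitrary, possibly infinite, set of rules; and $a\leftarrow$ denotes the rule with head $a$ and $\mathrm{pos}=\mathrm{neg}=\emptyset$. A set $X$ of atoms is an answer set for a program $P$ if $X$ is the least set $Y$ of atoms such that $\mathrm{head}(r)\in Y$ for every $r\in P$ with $\mathrm{neg}(r)\cap X=\emptyset$ and $\mathrm{pos}(r)\subseteq Y$. For an atom $a$, let $P_a^+$ and $P_a^-$ be the smallest sets of atoms such that $a\in P_a^+$ and, for every $r\in P$: if $\mathrm{head}(r)\in P_a^+$ then $\mathrm{pos}(r)\subseteq P_a^+$ and $\mathrm{neg}(r)\subseteq P_a^-$; if $\mathrm{head}(r)\in P_a^-$ then $\mathrm{pos}(r)\subseteq P_a^-$ and $\mathrm{neg}(r)\subseteq P_a^+$. The program $P$ is order-consistent if there is a function $\lambda$ from atoms to ordinals such that $\lambda(b)<\lambda(a)$ for all atoms $a$, $b$ with $b\in P_a^+\cap P_a^-$. Let $P$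 be an order-consistent program, and let $a$ be an atom that belongs to every answer set for $P$. Then every answer set for $P\cup\{a\leftarrow\}$ is an answer set for $P$. -/

import Mathlib

universe u

namespace NormalLP

/-- A rule `head ← pos, not neg` over the set `A` of atoms, with finite sets of subgoals. -/
@[ext]
structure Rule (A : Type u) where
  head : A
  pos : Finset A
  neg : Finset A

/-- A program is an arbitrary (possibly infinite) set of rules. -/
abbrev Program (A : Type u) := Set (Rule A)

variable {A : Type u}

/-- The rule `a ←`, without subgoals. -/
def Rule.fact (a : A) : Rule A := ⟨a, ∅, ∅⟩

/-- The rule obtained by dropping all negated subgoals. -/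
def Rule.positivePart (r : Rule A) : Rule A := ⟨r.head, r.pos, ∅⟩

/-- `X` is closed under the program `P`. Only used for positive programs `P`. -/
def Closed (P : Program A) (X : Set A) : Prop :=
  ∀ r ∈ P, (r.pos : Set A) ⊆ X → r.head ∈ X

/-- The reduct `P^X` of `P` relative to `X`; it is a positive program. -/
def reduct (P : Program A) (X : Set A) : Program A :=
  {r' | ∃ r ∈ P, (r.neg : Set A) ∩ X = ∅ ∧ r' = r.positivePart}

/-- `X` is an answer set for `P`: the least set of atoms closed under `P^X`. -/
def IsAnswerSet (P : Program A) (X : Set A) : Prop :=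
  IsLeast {Y : Set A | Closed (reduct P X) Y} X

/-- The set of consequences of `P`: the atoms that belong to every answer set for `P`. -/
def consequences (P : Program A) : Set A :=
  {a | ∀ X : Set A, IsAnswerSet P X → a ∈ X}

/-- The simultaneous inductive definition of the sets of atoms on which `a` depends
positively (`true`) and negatively (`false`) in `P`. -/
inductive Depends (P : Program A) (a : A) : Bool → A → Prop
  | refl : Depends P a true a
  | pos {s : Bool} {r : Rule A} {b : A} :
      r ∈ P → Depends P a s r.head → b ∈ r.pos → Depends P a s b
  | neg {s : Bool} {r : Rule A} {b : A} :
      r ∈ P → Depends P a s r.head → b ∈ r.neg → Depends P a (!s) b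

/-- The set `P_a⁺` of atoms on which `a` depends positively. -/
def posDeps (P : Program A) (a : A) : Set A := {b | Depends P a true b}

/-- The set `P_a⁻` of atoms on which `a` depends negatively. -/
def negDeps (P : Program A) (a : A) : Set A := {b | Depends P a false b}

/-- `P` is order-consistent: some level mapping into the ordinals strictly decreases from `a`
to each `b` on which `a` depends both positively and negatively. -/
def OrderConsistent (P : Program A) : Prop :=
  ∃ level : A → Ordinal.{u}, ∀ a b : A, b ∈ posDeps P a ∩ negDeps P a → level b < level a

end NormalLP

namespace NormalLP

variable {A : Type u}

/-! If `P` derives `a` relative to `X`, the added fact is redundant and `X` is an answer set for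
`P`. Otherwise an answer set for `P` without `a` is built. Order-consistency keeps `a` out of
`negDeps P a`, so there the fact is never used and `X` already satisfies the fixpoint condition.
`AnswersOn.exists_extension` turns this into a partial answer set on all dependencies of `a`,
bounded on `posDeps P a` by what `X` derives and hence omitting `a`;
`OrderConsistent.exists_isAnswerSet` extends it to all atoms. -/

/-- The atoms derivable from the reduct of `P` relative to `X`. -/
inductive Derives (P : Program A) (X : Set A) : A → Prop
  | rule {r : Rule A} : r ∈ P → (∀ b ∈ r.neg, b ∉ X) → (∀ b ∈ r.pos, Derives P X b) →
      Derives P X r.head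

theorem isLeast_derives (P : Program A) (X : Set A) :
    IsLeast {Y : Set A | Closed (reduct P X) Y} {c | Derives P X c} := by
  constructor
  · rintro _ ⟨r, hr, hneg, rfl⟩ hpos
    refine Derives.rule (r := r) hr (fun b hb hbX => ?_) (fun b hb => hpos hb)
    exact (Set.eq_empty_iff_forall_notMem.1 hneg b) ⟨hb, hbX⟩
  · intro Y hY c hc
    induction hc with
    | @rule r hr hneg _ ih =>
      refine hY r.positivePart ⟨r, hr, ?_, rfl⟩ (fun b hb => ih b hb)
      exact Set.eq_empty_iff_forall_notMem.2 fun b hb => hneg b hb.1 hb.2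

theorem isAnswerSet_iff {P : Program A} {X : Set A} :
    IsAnswerSet P X ↔ ∀ c, c ∈ X ↔ Derives P X c := by
  constructor
  · intro h c
    rw [h.unique (isLeast_derives P X)]
    exact Iff.of_eq (congrArg (fun Y => Derives P Y c) (h.unique (isLeast_derives P X)))
  · intro h
    have hX : X = {c | Derives P X c} := Set.ext h
    have := isLeast_derives P X
    rwa [← hX] at this

/-- Atoms of `S` depend positively only on atoms of `S`, and negatively only on atoms of `N`. -/
def Signed (P : Program A) (S N : Set A) : Prop :=
  ∀ r ∈ P, r.head ∈ S → (∀ b ∈ r.pos, b ∈ S) ∧ ∀ b ∈ r.neg, b ∈ N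

theorem signed_posDeps (P : Program A) (a : A) : Signed P (posDeps P a) (negDeps P a) :=
  fun _ hr h => ⟨fun _ hb => Depends.pos hr h hb, fun _ hb => Depends.neg hr h hb⟩

theorem signed_negDeps (P : Program A) (a : A) : Signed P (negDeps P a) (posDeps P a) :=
  fun _ hr h => ⟨fun _ hb => Depends.pos hr h hb, fun _ hb => Depends.neg hr h hb⟩

theorem Signed.union {P : Program A} {S N S' N' : Set A} (h : Signed P S N)
    (h' : Signed P S' N') : Signed P (S ∪ S') (N ∪ N') := by
  rintro r hr (hS | hS)
  · exact ⟨fun b hb => Or.inl ((h r hr hS).1 b hb), fun b hb => Or.inl ((h r hr hS).2 b hb)⟩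
  · exact ⟨fun b hb => Or.inr ((h' r hr hS).1 b hb), fun b hb => Or.inr ((h' r hr hS).2 b hb)⟩

theorem Signed.inter {P : Program A} {S N S' N' : Set A} (h : Signed P S N)
    (h' : Signed P S' N') : Signed P (S ∩ S') (N ∩ N') :=
  fun r hr hS => ⟨fun b hb => ⟨(h r hr hS.1).1 b hb, (h' r hr hS.2).1 b hb⟩,
    fun b hb => ⟨(h r hr hS.1).2 b hb, (h' r hr hS.2).2 b hb⟩⟩

/-- A derivation of an atom of `S` stays inside `S` and tests negated atoms only in `N`. -/
theorem Derives.anti {P : Program A} {S N X Y : Set A} (h : Signed P S N)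
    (hXY : ∀ c ∈ N, c ∈ X → c ∈ Y) {c : A} (hc : c ∈ S) (hd : Derives P Y c) :
    Derives P X c := by
  induction hd with
  | @rule r hr hneg _ ih =>
    have hs := h r hr hc
    exact .rule hr (fun b hb hbX => hneg b hb (hXY b (hs.2 b hb) hbX))
      fun b hb => ih b hb (hs.1 b hb)

theorem Derives.congr {P : Program A} {S N X Y : Set A} (h : Signed P S N)
    (hXY : ∀ c ∈ N, (c ∈ X ↔ c ∈ Y)) {c : A} (hc : c ∈ S) :
    Derives P X c ↔ Derives P Y c :=
  ⟨anti h (fun c hc => (hXY c hc).2) hc, anti h (fun c hc => (hXY c hc).1) hc⟩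

theorem Derives.mono_program {P Q : Program A} (hPQ : P ⊆ Q) {X : Set A} {c : A}
    (h : Derives P X c) : Derives Q X c := by
  induction h with
  | rule hr hneg _ ih => exact .rule (hPQ hr) hneg ih

/-- `Z` satisfies the fixpoint condition of answer sets at the atoms of `D`. -/
def AnswersOn (P : Program A) (D Z : Set A) : Prop :=
  ∀ c ∈ D, (c ∈ Z ↔ Derives P Z c)

theorem AnswersOn.congr {P : Program A} {D Z W : Set A} (hD : Signed P D D)
    (h : AnswersOn P D W) (hZW : ∀ c ∈ D, (c ∈ Z ↔ c ∈ W)) : AnswersOn P D Z :=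
  fun c hc => (hZW c hc).trans ((h c hc).trans (Derives.congr hD hZW hc).symm)

/-- A partial answer set extends over a signed pair whose overlap is already decided; the extension
can be kept below any prefixpoint of the twisted operator. -/
theorem AnswersOn.exists_extension {P : Program A} {D W S N : Set A} (hD : Signed P D D)
    (hW : AnswersOn P D W) (hS : Signed P S N) (hN : Signed P N S) (hSN : S ∩ N ⊆ D) :
    ∃ Z, AnswersOn P (D ∪ (S ∪ N)) Z ∧ (∀ c ∈ D, (c ∈ Z ↔ c ∈ W)) ∧
      ((∀ c ∈ S, Derives P W c → c ∈ W) → (∀ c ∈ N, c ∈ W → Derives P W c) →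
        ∀ c ∈ S, c ∉ D → c ∈ Z → Derives P W c) := by
  let f : Set A → Set A := fun y => {c | Derives P ((W ∩ D) ∪ (y ∩ (N \ D))) c}
  let g : Set A → Set A := fun x => {c | Derives P ((W ∩ D) ∪ (x ∩ (S \ D))) c}
  have huniv : Signed P (Set.univ : Set A) Set.univ :=
    fun _ _ _ => ⟨fun _ _ => trivial, fun _ _ => trivial⟩
  have hf : Antitone f := fun y y' h c hc =>
    Derives.anti huniv
      (fun _ _ => Or.imp id fun hb => ⟨h hb.1, hb.2⟩) trivial hc
  have hg : Antitone g := fun x x' h c hc =>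
    Derives.anti huniv
      (fun _ _ => Or.imp id fun hb => ⟨h hb.1, hb.2⟩) trivial hc
  -- A composite of two antitone maps is monotone. Its least fixed point is used because it lies
  -- below every prefixpoint.
  let T : Set A →o Set A := ⟨fun x => f (g x), fun x x' h => hf (hg h)⟩
  let x : Set A := T.lfp
  have hx : f (g x) = x := T.map_lfp
  let Z : Set A := (W ∩ D) ∪ ((x ∩ (S \ D)) ∪ (g x ∩ (N \ D)))
  have hZD : ∀ c ∈ D, (c ∈ Z ↔ c ∈ W) := by
    intro c hc
    simp [Z, hc]
  refine ⟨Z, ?_, hZD, ?_⟩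
  · intro c hc
    by_cases hcD : c ∈ D
    · exact hW.congr hD hZD c hcD
    rcases hc.resolve_left hcD with hcS | hcN
    · have hcN : c ∉ N := fun h => hcD (hSN ⟨hcS, h⟩)
      have h1 : c ∈ Z ↔ c ∈ f (g x) := by simp [Z, hcD, hcS, hcN, hx]
      rw [h1]
      refine Derives.congr hS (fun b hb => ?_) hcS
      have : b ∉ D → b ∉ S := fun h h' => h (hSN ⟨h', hb⟩)
      by_cases hbD : b ∈ D <;> simp_all [Z]
    · have hcS : c ∉ S := fun h => hcD (hSN ⟨h, hcN⟩)
      have h1 : c ∈ Z ↔ c ∈ g x := by simp [Z, hcD, hcS, hcN]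
      rw [h1]
      refine Derives.congr hN (fun b hb => ?_) hcN
      have : b ∉ D → b ∉ N := fun h h' => h (hSN ⟨hb, h'⟩)
      by_cases hbD : b ∈ D <;> simp_all [Z]
  · intro hWS hWN c hcS hcD hcZ
    -- The right-hand side is a prefixpoint of `T`: applying `g` to it yields every atom of `W` in
    -- `N`.
    have hle : x ≤ {c | c ∈ S → Derives P W c} := by
      refine T.lfp_le fun b hb hbS => ?_
      refine Derives.anti hS (fun d hdN hdW => ?_) hbS hb
      by_cases hdD : d ∈ D
      · exact Or.inl ⟨hdW, hdD⟩
      refine Or.inr ⟨?_, hdN, hdD⟩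
      refine Derives.anti hN (fun e heS he => ?_) hdN (hWN d hdN hdW)
      rcases he with he | he
      · exact he.1
      · exact hWS e heS (he.1 heS)
    have hcN : c ∉ N := fun h => hcD (hSN ⟨hcS, h⟩)
    have hcx : c ∈ x := by simpa [Z, hcD, hcS, hcN] using hcZ
    exact hle hcx hcS

/-- Every partial answer set of an order-consistent program, given on a dependency-closed set of
atoms, extends to an answer set. -/
theorem OrderConsistent.exists_isAnswerSet {P : Program A} (hP : OrderConsistent P) {D W : Set A}
    (hD : Signed P D D) (hW : AnswersOn P D W) :
    ∃ Z, IsAnswerSet P Z ∧ ∀ c ∈ D, (c ∈ Z ↔ c ∈ W) := by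
  obtain ⟨level, hlevel⟩ := hP
  let R : Set A × Set A → Set A × Set A → Prop :=
    fun p q => p.1 ⊆ q.1 ∧ ∀ c ∈ p.1, (c ∈ q.2 ↔ c ∈ p.2)
  have hR : ∀ {p q s}, R p q → R q s → R p s := fun hpq hqs =>
    ⟨hpq.1.trans hqs.1, fun c hc => (hqs.2 c (hpq.1 hc)).trans (hpq.2 c hc)⟩
  let Q := {p : Set A × Set A // Signed P p.1 p.1 ∧ AnswersOn P p.1 p.2 ∧ R (D, W) p}
  obtain ⟨⟨⟨E, Z⟩, hE, hZ, hDE⟩, hmax⟩ :=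
    exists_maximal_of_chains_bounded (r := fun p q : Q => R p.1 q.1) (by
      intro C hC
      let p₀ : Q := ⟨(D, W), hD, hW, subset_rfl, fun _ _ => Iff.rfl⟩
      -- Adding `p₀` makes the union extend `(D, W)` even when `C` is empty.
      let C' : Set Q := insert p₀ C
      have hC' : ∀ p ∈ C', ∀ q ∈ C', R p.1 q.1 ∨ R q.1 p.1 := by
        rintro p (rfl | hp) q (rfl | hq)
        · exact Or.inl ⟨subset_rfl, fun _ _ => Iff.rfl⟩
        · exact Or.inl q.2.2.2
        · exact Or.inr p.2.2.2
        · rcases eq_or_ne p q with rfl | hne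
          · exact Or.inl ⟨subset_rfl, fun _ _ => Iff.rfl⟩
          · exact hC hp hq hne
      let E : Set A := {c | ∃ p ∈ C', c ∈ p.1.1}
      let Z : Set A := {c | ∃ p ∈ C', c ∈ p.1.1 ∧ c ∈ p.1.2}
      have hub : ∀ p ∈ C', R p.1 (E, Z) := by
        refine fun p hp => ⟨fun c hc => ⟨p, hp, hc⟩, fun c hc => ⟨?_, fun h => ⟨p, hp, hc, h⟩⟩⟩
        rintro ⟨q, hq, hcq, hcZ⟩
        rcases hC' p hp q hq with h | h
        · exact (h.2 c hc).1 hcZ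
        · exact (h.2 c hcq).2 hcZ
      refine ⟨⟨(E, Z), ?_, ?_, hub p₀ (Set.mem_insert _ _)⟩,
        fun p hp => hub p (Set.mem_insert_of_mem _ hp)⟩
      · rintro r hr ⟨p, hp, hc⟩
        exact ⟨fun b hb => ⟨p, hp, (p.2.1 r hr hc).1 b hb⟩,
          fun b hb => ⟨p, hp, (p.2.1 r hr hc).2 b hb⟩⟩
      · rintro c ⟨p, hp, hc⟩
        exact p.2.2.1.congr p.2.1 (hub p hp).2 c hc)
      (fun {_ _ _} => hR)
  have hall : ∀ c, c ∈ E := by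
    by_contra! hne
    obtain ⟨b, hb, hmin⟩ :=
      (InvImage.wf level (wellFounded_lt (α := Ordinal.{u}))).has_min {c | c ∉ E} hne
    -- The overlap has lower level than `b`, so minimality of `b` puts it in `E`.
    have hov : posDeps P b ∩ negDeps P b ⊆ E := fun c hc => by
      by_contra hcE
      exact hmin c hcE (hlevel b c hc)
    obtain ⟨Z', hZ', hZZ', -⟩ :=
      hZ.exists_extension hE (signed_posDeps P b) (signed_negDeps P b) hov
    have hE' : Signed P (E ∪ (posDeps P b ∪ negDeps P b)) (E ∪ (posDeps P b ∪ negDeps P b)) := by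
      have h := hE.union ((signed_posDeps P b).union (signed_negDeps P b))
      rwa [Set.union_comm (negDeps P b)] at h
    have hle : R (E, Z) (E ∪ (posDeps P b ∪ negDeps P b), Z') := ⟨Set.subset_union_left, hZZ'⟩
    exact hb ((hmax ⟨(_, Z'), hE', hZ', hR hDE hle⟩ hle).1 (Or.inr (Or.inl Depends.refl)))
  exact ⟨Z, isAnswerSet_iff.2 fun c => hZ c (hall c), hDE.2⟩

/-- Adding the fact `a` does not affect derivability in a signed part of the program avoiding `a`. -/
theorem Derives.of_union_fact {P : Program A} {a : A} {S N X : Set A} (h : Signed P S N)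
    (ha : a ∉ S) {c : A} (hc : c ∈ S) (hd : Derives (P ∪ {Rule.fact a}) X c) :
    Derives P X c := by
  induction hd with
  | @rule r hr hneg _ ih =>
    rcases hr with hr | rfl
    · exact .rule hr hneg fun b hb => ih b hb ((h r hr hc).1 b hb)
    · exact absurd hc ha

theorem Derives.of_union_fact_of_derives {P : Program A} {a : A} {X : Set A}
    (ha : Derives P X a) {c : A} (hd : Derives (P ∪ {Rule.fact a}) X c) : Derives P X c := by
  induction hd with
  | @rule r hr hneg _ ih =>
    rcases hr with hr | rfl
    · exact .rule hr hneg ih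
    · exact ha

end NormalLP

open NormalLP in
theorem theorem1 {A : Type u} (P : NormalLP.Program A) (hP : NormalLP.OrderConsistent P)
    (a : A) (ha : a ∈ NormalLP.consequences P) :
    ∀ X : Set A, NormalLP.IsAnswerSet (P ∪ {NormalLP.Rule.fact a}) X →
      NormalLP.IsAnswerSet P X := by
  intro X hX
  rw [isAnswerSet_iff] at hX
  have hsub : ∀ c, Derives P X c → c ∈ X := fun c hc =>
    (hX c).2 (hc.mono_program Set.subset_union_left)
  by_cases haX : Derives P X a
  · exact isAnswerSet_iff.2 fun c =>
      ⟨fun hc => Derives.of_union_fact_of_derives haX ((hX c).1 hc), hsub c⟩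
  exfalso
  have haN : a ∉ negDeps P a := fun h => by
    obtain ⟨level, hlevel⟩ := hP
    exact lt_irrefl _ (hlevel a a ⟨Depends.refl, h⟩)
  have hXN : ∀ c ∈ negDeps P a, c ∈ X → Derives P X c := fun c hc hcX =>
    ((hX c).1 hcX).of_union_fact (signed_negDeps P a) haN hc
  have hD : Signed P (posDeps P a ∩ negDeps P a) (posDeps P a ∩ negDeps P a) := by
    have h := (signed_posDeps P a).inter (signed_negDeps P a)
    rwa [Set.inter_comm (negDeps P a)] at h
  obtain ⟨Z, hZ, -, hbound⟩ := AnswersOn.exists_extension (W := X) hD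
    (fun c hc => ⟨hXN c hc.2, hsub c⟩) (signed_posDeps P a) (signed_negDeps P a) subset_rfl
  have haZ : a ∉ Z := fun h =>
    haX (hbound (fun c _ => hsub c) hXN a Depends.refl (fun h' => haN h'.2) h)
  have hE := hD.union ((signed_posDeps P a).union (signed_negDeps P a))
  rw [Set.union_comm (negDeps P a)] at hE
  obtain ⟨Y, hY, hYZ⟩ := hP.exists_isAnswerSet hE hZ
  exact haZ ((hYZ a (Or.inr (Or.inl Depends.refl))).1 (ha Y hY))
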